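/- A prophet-inequality instance consists of a family $\mathcal I$ of feasible subsets of $[n]$ and of probability distributions $D_1,\dots,D_n$ on $[0,\infty)$. Independent values $X_i\sim D_i$ are revealed in the order $1,\dots,n$. A gambler, who knows $\mathcal I$ and $D_1,\dots,D_n$, accepts or rejects element $i$ irrevocably when $X_i$ is revealed, using only $X_1,\dots,X_i$, and the set of accepted elements must belong to $\mathcal I$ at all times. Let $\alpha(\mathcal I,\vec D)$ be the ratio of $\mathbb E\big[\max_{S\in\mathcal I}\sum_{i\in S}X_i\big]$ to the optimal expected total value of the elements accepted by a gambler. A partition matroid on $[n]$ is given by a partition of $[n]$; its feasible sets are the sets that meet each part in at most one element. Let $\mathcal C_{\mathrm{PartInt}}(q)$ be the class of all $\mathcal I$ (on $[n]$, for any $n$) that are the intersection of $q$ partition matroids, and let $\alpha(\mathcal C_{\mathrm{PartInt}}(q))$ be the supremum of $\alpha(\mathcal I,\vec D)$ over all $n$, all such $\mathcal I$ on $[n]$ and all $D_1,\dots,D_n$. Call $\mathcal I$ fully symmetric if for all elements $x,y$ there is a permutation $\sigma$ of $[n]$ with $\sigma(x)=y$ such that $S\in\mathcal I\Leftrightarrow\sigma(S)\in\mathcal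 I$ for all $S\subseteq[n]$. **Theorem.** There are an absolute constant $c>0$ and an integer $q_0$ such that for all integers $q\ge q_0$, $$\alpha(\mathcal C_{\mathrm{PartInt}}(q))\;\ge\; q^{\frac12+\frac{c}{\log\log q}}.$$ The bound is already witnessed by fully symmetric instances with i.i.d. Bernoulli values: for every $q\ge q_0$ there are an $n$, a fully symmetric $\mathcal I$ on $[n]$ that is the intersection of $q$ partition matroids, and a Bernoulli distribution $D$ on $\{0,1\}$ with $\alpha(\mathcal I,(D,\dots,D))\ge q^{1/2+c/\log\log q}$. In particular, the supremum of $\alpha(\mathcal I,\vec D)$ over these fully symmetric i.i.d. Bernoulli instances satisfies the same lower bound. -/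

import Mathlib

open MeasureTheory
open scoped NNReal ENNReal

namespace Prophet

/-- A feasibility constraint on the elements `0, …, n-1`: the family of the feasible sets. -/
abbrev Constraint (n : ℕ) : Type := Set (Finset (Fin n))

/-- The partition matroids: for some partition of the ground set, exactly those sets are feasible
that meet every part of it in at most one element. -/
def IsPartitionMatroid {n : ℕ} (I : Constraint n) : Prop :=
  ∃ π : Finpartition (Finset.univ : Finset (Fin n)),
    I = {T | ∀ S ∈ π.parts, (T ∩ S).card ≤ 1}

/-- `I` is the intersection of `q` partition matroids. -/
def IsPartInt (q : ℕ) {n : ℕ} (I : Constraint n) : Prop :=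
  ∃ J : Fin q → Constraint n, (∀ j, IsPartitionMatroid (J j)) ∧ I = ⋂ j, J j

/-- `I` is invariant under the permutation `σ` of the elements. -/
def IsInvariant {n : ℕ} (I : Constraint n) (σ : Equiv.Perm (Fin n)) : Prop :=
  ∀ S : Finset (Fin n), S ∈ I ↔ S.map σ.toEmbedding ∈ I

/-- `I` is fully symmetric: every element is taken to every other one by a permutation that leaves
`I` invariant. -/
def IsFullySymmetric {n : ℕ} (I : Constraint n) : Prop :=
  ∀ x y : Fin n, ∃ σ : Equiv.Perm (Fin n), σ x = y ∧ IsInvariant I σ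

/-- A (deterministic) strategy of the gambler under the constraint `I`. The values arrive in the
order `0, 1, …, n-1`, and `accepted x` is the set of the elements that are accepted when the values
are `x`. -/
structure GamblerStrategy {n : ℕ} (I : Constraint n) where
  /-- the set of the accepted elements -/
  accepted : (Fin n → ℝ≥0) → Finset (Fin n)
  /-- whether `i` is accepted depends only on the values revealed up to and including `i` -/
  online : ∀ (i : Fin n) (x y : Fin n → ℝ≥0), (∀ j ≤ i, x j = y j) →
    (i ∈ accepted x ↔ i ∈ accepted y)
  /-- at all times, the set of the elements accepted so far is feasible -/
  feasible : ∀ (x : Fin n → ℝ≥0) (t : ℕ), (accepted x).filter (fun i : Fin n => (i : ℕ) < t) ∈ I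
  measurable : ∀ i, MeasurableSet {x | i ∈ accepted x}

/-- The law of independent values with the laws `D 0, …, D (n-1)`. -/
noncomputable def valueLaw {n : ℕ} (D : Fin n → ProbabilityMeasure ℝ≥0) :
    Measure (Fin n → ℝ≥0) :=
  Measure.pi (fun i => (D i : Measure ℝ≥0))

/-- The expected reward of the prophet: the expectation of the largest total value of a feasible
set. -/
noncomputable def prophetValue {n : ℕ} (I : Constraint n)
    (D : Fin n → ProbabilityMeasure ℝ≥0) : ℝ≥0∞ :=
  ∫⁻ x, ⨆ S ∈ I, ∑ i ∈ S, (x i : ℝ≥0∞) ∂(valueLaw D)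

/-- The expected reward of a strategy. -/
noncomputable def GamblerStrategy.value {n : ℕ} {I : Constraint n} (A : GamblerStrategy I)
    (D : Fin n → ProbabilityMeasure ℝ≥0) : ℝ≥0∞ :=
  ∫⁻ x, ∑ i ∈ A.accepted x, (x i : ℝ≥0∞) ∂(valueLaw D)

/-- The optimal expected reward of a gambler. -/
noncomputable def gamblerValue {n : ℕ} (I : Constraint n)
    (D : Fin n → ProbabilityMeasure ℝ≥0) : ℝ≥0∞ :=
  ⨆ A : GamblerStrategy I, A.value D

/-- The approximability `α(I, D)` of an instance. -/
noncomputable def approximability {n : ℕ} (I : Constraint n)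
    (D : Fin n → ProbabilityMeasure ℝ≥0) : ℝ≥0∞ :=
  prophetValue I D / gamblerValue I D

/-- The approximability `α(C, P)` of an ensemble `C` of classes of constraints together with an
ensemble `P` of classes of product distributions. -/
noncomputable def alphaWith (C : ∀ n : ℕ, Set (Constraint n))
    (P : ∀ n : ℕ, Set (Fin n → ProbabilityMeasure ℝ≥0)) : ℝ≥0∞ :=
  ⨆ n : ℕ, ⨆ I ∈ C n, ⨆ D ∈ P n, approximability I D

/-- The approximability `α(C)`: all product distributions are allowed. -/
noncomputable def alpha (C : ∀ n : ℕ, Set (Constraint n)) : ℝ≥0∞ :=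
  alphaWith C (fun _ => Set.univ)

/-- The constraints that are the intersection of `q` partition matroids. -/
def partInt (q n : ℕ) : Set (Constraint n) := {I | IsPartInt q I}

/-- The fully symmetric constraints that are the intersection of `q` partition matroids. -/
def symPartInt (q n : ℕ) : Set (Constraint n) := {I | IsFullySymmetric I ∧ IsPartInt q I}

/-- The i.i.d. Bernoulli distributions: every value is `1` with probability `b`, and `0`
otherwise. -/
def iidBernoulli (n : ℕ) : Set (Fin n → ProbabilityMeasure ℝ≥0) :=
  {D | ∃ b : unitInterval, ∀ i,
    (D i : Measure ℝ≥0) = ProbabilityTheory.bernoulliMeasure (1 : ℝ≥0) 0 b}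

/-- The bound `q ^ (1/2 + c / log log q)`. -/
noncomputable def bound (c : ℝ) (q : ℕ) : ℝ≥0∞ :=
  ENNReal.ofReal ((q : ℝ) ^ (1 / 2 + c / Real.log (Real.log (q : ℝ)) : ℝ))

end Prophet

/-!
The instances are those of Kleinberg and Weinberg: disjoint groups of `p` elements each, at least
`p ^ p` of them, where a set is feasible if it is contained in one group and every value is `1`
with probability `1 / p` and `0` otherwise. With probability at least `1 / 2` some group consists
of ones only, so the prophet gets at least `p / 2` (`half_le_prophetValue`). Once the gambler has
accepted an element, only later elements of the same group can follow, and their values are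
independent of the event that this element was the first one accepted; so the gambler gets at most
`1 + p * (1 / p) = 2` (`value_le_two`). The ratio is at least `p / 4`, and everything depends on
writing the constraint with as few partition matroids as possible.

A partition matroid is given by a colouring of the elements, and the constraint is the
intersection of the given partition matroids when each colouring is injective on each group and any
two elements of different groups share some colour (`isPartInt_groupConstraint`). Let `K` be the
field with `2 ^ u` elements, and let the elements be the pairs `(a, s)` of a group `a` and a vector
`s : Fin (g + 1) → K`, so that `p = 2 ^ (u * (g + 1))`. Given a code `F` over `K`, with a word for
every group, such that any two words show every nonzero difference in some position, the colourings
`(a, s) ↦ s + F a i • w`, where `w` has some coordinate equal to `1`, suffice together with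
`(a, s) ↦ s` (`isPartInt_of_code`).

The code comes from a chaining construction in the manner of Gargano, Körner and Vaccaro, which
Alon and Alweiss applied to product dimensions. The words of length one are coloured by the cosets
of `{0, d}`, so that two different words of the same colour differ by `d`. Suppose `κ₁` and `κ₂` do
this for the sets `D₁` and `D₂` of differences. For words of `t` blocks, prescribe the differences
between the `κ₁`-colour of each block and the `κ₂`-colour of the preceding one. Two words with the
same prescribed data have the same `κ₁`-colour in the first block in which they differ, and the same
`κ₂`-colour in the last one, so that they show all the differences in `D₁ ∪ D₂`
(`separates_chainColor`). This costs only `t + 1` colours for `t` blocks. After `u` rounds all the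
nonzero differences are shown by words of length `t ^ u` with `2 ^ ((u - 1) * (t + 1) ^ u)` colours
in all, and for `t ≥ 2 * u ^ 2` the pigeonhole principle gives a code with at least
`2 ^ (t ^ u / 2)` words (`exists_code`, `sub_one_mul_succ_pow_add_le`). For `t = 3 * 2 ^ g` these
are enough words for the groups, while the number of colourings, about
`(g + 1) * (3 / 4) ^ u * p ^ 2`, is below `p ^ 2` by a factor exponential in `u`. The condition on
`t` holds already for `g` of order `log u`, so that `u` can be of order `log q / log log q`.
-/

namespace Prophet

/-! ### Codes in which any two words show every difference -/

/-- The colouring `κ` of the words `ι → V` separates `D`: two different words of the same colour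
show each difference `d ∈ D` in some position. A colour class of `κ` is then a code all of whose
pairs of words show all the differences in `D`. -/
def Separates {ι V C : Type*} [Sub V] (κ : (ι → V) → C) (D : Set V) : Prop :=
  ∀ x y, x ≠ y → κ x = κ y → ∀ d ∈ D, ∃ i, x i - y i = d

/-- The `j`-th block of a word whose positions are indexed by `(h + 1)`-tuples. -/
def block {V : Type*} {h t : ℕ} (x : (Fin (h + 1) → Fin t) → V) (j : Fin t) :
    (Fin h → Fin t) → V :=
  fun f => x (Fin.cons j f)

lemma exists_block_ne {V : Type*} {h t : ℕ} {x y : (Fin (h + 1) → Fin t) → V} (hxy : x ≠ y) :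
    ∃ j, block x j ≠ block y j := by
  by_contra! hne
  refine hxy (funext fun f => ?_)
  have := congrFun (hne (f 0)) (Fin.tail f)
  simpa [block] using this

/-- The chaining of two colourings over `t` blocks: the `j`-th component is the difference of the
`κ₁`-colour of block `j` and the `κ₂`-colour of block `j - 1`, where the colours missing at the two
ends count as `0`. -/
def chainColor {V C : Type*} [AddGroup C] {h t : ℕ} (κ₁ κ₂ : ((Fin h → Fin t) → V) → C)
    (x : (Fin (h + 1) → Fin t) → V) (j : Fin (t + 1)) : C :=
  Fin.snoc (α := fun _ => C) (fun i => κ₁ (block x i)) 0 j -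
    Fin.cons (α := fun _ => C) 0 (fun i => κ₂ (block x i)) j

/-- If the blocks of two words before block `j` coincide and the words have the same chained
colour, then their blocks `j` have the same `κ₁`-colour. -/
lemma left_color_eq {V C : Type*} [AddGroup C] {h t : ℕ} {κ₁ κ₂ : ((Fin h → Fin t) → V) → C}
    {x y : (Fin (h + 1) → Fin t) → V} (hc : chainColor κ₁ κ₂ x = chainColor κ₁ κ₂ y) (j : Fin t)
    (hlt : ∀ i < j, block x i = block y i) : κ₁ (block x j) = κ₁ (block y j) := by
  have hj := congrFun hc j.castSucc
  have hcons : Fin.cons (α := fun _ => C) 0 (fun i => κ₂ (block x i)) j.castSucc =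
      Fin.cons (α := fun _ => C) 0 (fun i => κ₂ (block y i)) j.castSucc := by
    rcases Fin.eq_zero_or_eq_succ j.castSucc with h0 | ⟨i, hi⟩
    · rw [h0]; rfl
    · rw [hi, Fin.cons_succ, Fin.cons_succ, hlt i]
      have := congrArg Fin.val hi
      simp only [Fin.val_castSucc, Fin.val_succ] at this
      exact Fin.lt_def.2 (by omega)
  simpa [chainColor, hcons] using hj

/-- If the blocks of two words after block `j` coincide and the words have the same chained
colour, then their blocks `j` have the same `κ₂`-colour. -/
lemma right_color_eq {V C : Type*} [AddGroup C] {h t : ℕ} {κ₁ κ₂ : ((Fin h → Fin t) → V) → C}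
    {x y : (Fin (h + 1) → Fin t) → V} (hc : chainColor κ₁ κ₂ x = chainColor κ₁ κ₂ y) (j : Fin t)
    (hlt : ∀ i, j < i → block x i = block y i) : κ₂ (block x j) = κ₂ (block y j) := by
  have hj := congrFun hc j.succ
  have hsnoc : Fin.snoc (α := fun _ => C) (fun i => κ₁ (block x i)) 0 j.succ =
      Fin.snoc (α := fun _ => C) (fun i => κ₁ (block y i)) 0 j.succ := by
    rcases Fin.eq_castSucc_or_eq_last j.succ with ⟨i, hi⟩ | hl
    · rw [hi, Fin.snoc_castSucc, Fin.snoc_castSucc, hlt i]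
      have := congrArg Fin.val hi
      simp only [Fin.val_castSucc, Fin.val_succ] at this
      exact Fin.lt_def.2 (by omega)
    · rw [hl, Fin.snoc_last, Fin.snoc_last]
  simpa [chainColor, hsnoc] using hj

/-- Two words of the same chained colour have the same `κ₁`-colour in the first block in which
they differ, and the same `κ₂`-colour in the last one. -/
lemma separates_chainColor {V C : Type*} [Sub V] [AddGroup C] {h t : ℕ}
    {κ₁ κ₂ : ((Fin h → Fin t) → V) → C} {D₁ D₂ : Set V}
    (h₁ : Separates κ₁ D₁) (h₂ : Separates κ₂ D₂) :
    Separates (chainColor κ₁ κ₂) (D₁ ∪ D₂) := by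
  classical
  intro x y hxy hc d hd
  have hne : (Finset.univ.filter fun j => block x j ≠ block y j).Nonempty := by
    obtain ⟨j, hj⟩ := exists_block_ne hxy
    exact ⟨j, by simpa using hj⟩
  rcases hd with hd | hd
  · obtain ⟨j, hj, hmin⟩ := Finset.exists_minimal hne
    have hlt : ∀ i < j, block x i = block y i := fun i hi => by
      by_contra hcon
      exact absurd (hmin (by simpa using hcon) hi.le) (not_le.2 hi)
    obtain ⟨f, hf⟩ := h₁ _ _ (by simpa using hj) (left_color_eq hc j hlt) d hd
    exact ⟨Fin.cons j f, hf⟩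
  · obtain ⟨j, hj, hmax⟩ := Finset.exists_maximal hne
    have hlt : ∀ i, j < i → block x i = block y i := fun i hi => by
      by_contra hcon
      exact absurd (hmax (by simpa using hcon) hi.le) (not_le.2 hi)
    obtain ⟨f, hf⟩ := h₂ _ _ (by simpa using hj) (right_color_eq hc j hlt) d hd
    exact ⟨Fin.cons j f, hf⟩

lemma Separates.comp_injective {ι V C C' : Type*} [Sub V] {κ : (ι → V) → C} {D : Set V}
    (hκ : Separates κ D) {f : C → C'} (hf : Function.Injective f) :
    Separates (fun x => f (κ x)) D :=
  fun x y hxy hc => hκ x y hxy (hf hc)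

/-- In a group in which every element is its own inverse, the cosets of `{0, d}` are a colouring
of the one-letter words that separates `d`. -/
lemma exists_coset_color {V C : Type*} [AddCommGroup V] [Finite V] [Finite C]
    (hV : ∀ v : V, v + v = 0) (hC : Nat.card V = 2 * Nat.card C) {d : V} (hd : d ≠ 0) :
    ∃ κ : V → C, ∀ x y, x ≠ y → κ x = κ y → x - y = d := by
  have hord : addOrderOf d = 2 := addOrderOf_eq_prime (by rw [two_nsmul, hV]) hd
  have hcard : Nat.card (V ⧸ AddSubgroup.zmultiples d) = Nat.card C := by
    have h1 := AddSubgroup.card_eq_card_quotient_mul_card_addSubgroup (AddSubgroup.zmultiples d)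
    rw [Nat.card_zmultiples, hord, hC] at h1
    omega
  obtain ⟨e⟩ : Nonempty ((V ⧸ AddSubgroup.zmultiples d) ≃ C) :=
    ⟨(Finite.equivFinOfCardEq hcard).trans (Finite.equivFin C).symm⟩
  refine ⟨fun v => e (QuotientAddGroup.mk v), fun x y hxy hc => ?_⟩
  have hmem : -y + x ∈ AddSubgroup.zmultiples d := QuotientAddGroup.eq.1 (e.injective hc).symm
  obtain ⟨n, hn⟩ := AddSubgroup.mem_zmultiples_iff.1 hmem
  have hn' : n • d = x - y := by rw [hn]; abel
  have h2 : (2 : ℤ) • d = 0 := by rw [two_zsmul, hV]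
  rcases Int.even_or_odd' n with ⟨k, rfl | rfl⟩
  · rw [mul_comm, mul_zsmul, h2, zsmul_zero] at hn'
    exact absurd (sub_eq_zero.1 hn'.symm) hxy
  · rw [add_zsmul, mul_comm, mul_zsmul, h2, zsmul_zero, zero_add, one_zsmul] at hn'
    exact hn'.symm

/-- Halving `D` repeatedly and chaining the colourings of the two halves, `2 ^ h` differences are
separated by a colouring of the words with `t ^ h` positions whose colours are words with
`(t + 1) ^ h` positions over an alphabet half as large. -/
lemma exists_separates {V C : Type*} [AddCommGroup V] [Finite V] [AddGroup C] [Finite C]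
    (hV : ∀ v : V, v + v = 0) (hC : Nat.card V = 2 * Nat.card C) (t h : ℕ) :
    ∀ D : Finset V, D.card ≤ 2 ^ h → 0 ∉ D →
      ∃ κ : ((Fin h → Fin t) → V) → ((Fin h → Fin (t + 1)) → C), Separates κ (D : Set V) := by
  classical
  induction h with
  | zero =>
    intro D hD h0
    rcases D.eq_empty_or_nonempty with rfl | ⟨d, hd⟩
    · exact ⟨fun _ _ => 0, fun x y _ _ d hd => by simp at hd⟩
    · have hDd : ∀ e ∈ D, e = d := fun e he => Finset.card_le_one.1 (by simpa using hD) e he d hd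
      obtain ⟨κ, hκ⟩ := exists_coset_color (C := C) hV hC (d := d) (fun h => h0 (h ▸ hd))
      refine ⟨fun x _ => κ (x default), fun x y hxy hc e he => ⟨default, ?_⟩⟩
      rw [hDd e he]
      refine hκ _ _ (fun heq => hxy (funext fun f => ?_)) (congrFun hc default)
      rw [Subsingleton.elim f default, heq]
  | succ h ih =>
    intro D hD h0
    obtain ⟨D₁, hD₁, hc₁⟩ := Finset.exists_subset_card_eq (s := D) (n := min D.card (2 ^ h))
      (min_le_left _ _)
    have hc₂ : (D \ D₁).card ≤ 2 ^ h := by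
      rw [Finset.card_sdiff_of_subset hD₁, hc₁]
      rw [pow_succ] at hD
      omega
    obtain ⟨κ₁, h₁⟩ := ih D₁ (by omega) (fun h => h0 (hD₁ h))
    obtain ⟨κ₂, h₂⟩ := ih (D \ D₁) hc₂ (fun h => h0 (Finset.mem_sdiff.1 h).1)
    have hsep := separates_chainColor h₁ h₂
    rw [← Finset.coe_union, Finset.union_sdiff_of_subset hD₁] at hsep
    exact ⟨_, hsep.comp_injective (Fin.consEquiv (fun _ : Fin (h + 1) => Fin (t + 1))
      |>.symm.arrowCongr (Equiv.refl C) |>.symm.injective |>.comp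
        (Equiv.curry _ _ C).symm.injective)⟩

/-- A largest colour class is a code in which any two words show every nonzero difference. -/
lemma exists_code {V : Type*} [AddCommGroup V] [Finite V] (hV : ∀ v : V, v + v = 0) {u : ℕ}
    (hu : 1 ≤ u) (hcard : Nat.card V = 2 ^ u) (t N : ℕ)
    (hN : 2 ^ ((u - 1) * (t + 1) ^ u) * N ≤ 2 ^ (u * t ^ u)) :
    ∃ F : Fin N → (Fin u → Fin t) → V,
      ∀ a b, a ≠ b → ∀ d : V, d ≠ 0 → ∃ i, F a i - F b i = d := by
  classical
  have := Fintype.ofFinite V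
  have hne : NeZero (2 ^ (u - 1)) := ⟨by positivity⟩
  obtain ⟨κ, hκ⟩ := exists_separates (C := ZMod (2 ^ (u - 1))) hV
    (by rw [hcard, Nat.card_zmod, ← pow_succ', Nat.sub_add_cancel hu]) t u
    (Finset.univ.erase (0 : V)) (by
      refine (Finset.card_le_card (Finset.erase_subset _ _)).trans ?_
      rw [Finset.card_univ, ← Nat.card_eq_fintype_card, hcard]) (by simp)
  obtain ⟨c, hc⟩ := Fintype.exists_le_card_fiber_of_mul_le_card κ (n := N) (by
    simp only [Fintype.card_fun, Fintype.card_fin, ZMod.card]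
    rwa [← Nat.card_eq_fintype_card (α := V), hcard, ← pow_mul, ← pow_mul])
  obtain ⟨A, hA, hcA⟩ := Finset.exists_subset_card_eq hc
  let e := A.equivFinOfCardEq hcA
  refine ⟨fun a => (e.symm a : (Fin u → Fin t) → V), fun a b hab d hd => ?_⟩
  have hcol : ∀ a, κ (e.symm a : (Fin u → Fin t) → V) = c := fun a =>
    (Finset.mem_filter.1 (hA (e.symm a).2)).2
  refine hκ _ _ (fun h => hab ?_) ((hcol a).trans (hcol b).symm) d (by simpa using hd)
  exact e.symm.injective (Subtype.ext h)

/-! ### The constraint of a disjoint union of cliques -/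

/-- The elements are divided into groups, `grp x` being the group of `x`; the feasible sets are
those contained in a single group. -/
def groupConstraint {n : ℕ} {Γ : Type*} (grp : Fin n → Γ) : Constraint n :=
  {T | ∀ x ∈ T, ∀ y ∈ T, grp x = grp y}

/-- The sets on which a colouring is injective form a partition matroid, whose parts are the
colour classes. -/
lemma isPartitionMatroid_injOn {n : ℕ} {S : Type*} (col : Fin n → S) :
    IsPartitionMatroid {T : Finset (Fin n) | ∀ x ∈ T, ∀ y ∈ T, col x = col y → x = y} := by
  classical
  refine ⟨Finpartition.ofSetoid (Setoid.ker col), Set.ext fun T => ⟨fun hT P hP => ?_, ?_⟩⟩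
  · refine Finset.card_le_one.2 fun x hx y hy => ?_
    rw [Finset.mem_inter] at hx hy
    refine hT x hx.1 y hy.1 ?_
    have := Finpartition.part_eq_of_mem _ hP hx.2
    exact Finpartition.mem_part_ofSetoid_iff_rel.1 (this.symm ▸ hy.2)
  · intro hT x hx y hy hxy
    have hP := hT _ ((Finpartition.ofSetoid (Setoid.ker col)).part_mem.2 (Finset.mem_univ x))
    refine Finset.card_le_one.1 hP x ?_ y ?_
    · exact Finset.mem_inter.2 ⟨hx, Finpartition.mem_part_ofSetoid_iff_rel.2 rfl⟩
    · exact Finset.mem_inter.2 ⟨hy, Finpartition.mem_part_ofSetoid_iff_rel.2 hxy⟩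

/-- A group constraint is the intersection of `q` partition matroids as soon as there are at most
`q` colourings, each injective on every group, such that any two elements of different groups have
the same colour in one of them. (The product dimension of a union of disjoint cliques.) -/
lemma isPartInt_groupConstraint {n q : ℕ} {Γ S Ω : Type*} [Finite Ω] [Nonempty Ω]
    {grp : Fin n → Γ} (hq : Nat.card Ω ≤ q) (col : Ω → Fin n → S)
    (hinj : ∀ ω x y, grp x = grp y → col ω x = col ω y → x = y)
    (hcol : ∀ x y, grp x ≠ grp y → ∃ ω, col ω x = col ω y) :
    IsPartInt q (groupConstraint grp) := by
  have := Fintype.ofFinite Ω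
  obtain ⟨f, hf⟩ : ∃ f : Fin q → Ω, Function.Surjective f := by
    obtain ⟨g⟩ := Function.Embedding.nonempty_of_card_le (α := Ω) (β := Fin q)
      (by rwa [Fintype.card_fin, ← Nat.card_eq_fintype_card])
    exact ⟨Function.invFun g, Function.invFun_surjective g.injective⟩
  refine ⟨fun j => _, fun j => isPartitionMatroid_injOn (col (f j)), Set.ext fun T => ?_⟩
  rw [Set.mem_iInter]
  refine ⟨fun hT j x hx y hy => hinj _ x y (hT x hx y hy), fun hT x hx y hy => ?_⟩
  by_contra hne
  obtain ⟨ω, hω⟩ := hcol x y hne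
  obtain ⟨j, rfl⟩ := hf ω
  exact hne (congrArg grp (hT j x hx y hy hω))

/-- Equally large groups can be permuted among each other, and so can the elements of each. -/
lemma isFullySymmetric_groupConstraint {n : ℕ} {Γ S : Type*} (e : Fin n ≃ Γ × S) :
    IsFullySymmetric (groupConstraint fun x => (e x).1) := by
  classical
  intro x y
  let σ : Equiv.Perm (Fin n) := (e.trans ((Equiv.swap (e x).1 (e y).1).prodCongr
    (Equiv.swap (e x).2 (e y).2))).trans e.symm
  have hσ : ∀ z, (e (σ z)).1 = Equiv.swap (e x).1 (e y).1 (e z).1 := fun z => by simp [σ]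
  refine ⟨σ, e.injective (by simp [σ, Prod.map]), fun T => ?_⟩
  simp only [groupConstraint, Set.mem_ofPred_eq, Finset.forall_mem_map, Equiv.coe_toEmbedding, hσ,
    (Equiv.swap (e x).1 (e y).1).injective.eq_iff]

/-! ### Few colourings -/

/-- Let `F` be a code over a finite field `K` in which any two words show every nonzero
difference. The elements `(a, s)`, with `s` a vector over `K`, are coloured by `s` itself and by
the vectors `s + F a i • w`, where `w` has some coordinate equal to `1`. If `a ≠ b`, then
`s + F a i • w = s' + F b i • w` amounts to `s' - s = (F a i - F b i) • w`, and each nonzero vector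
`s' - s` is a multiple of such a `w`. -/
lemma isPartInt_of_code {n q m g : ℕ} {K I : Type*} [Field K] [Finite K] [Finite I]
    (e : Fin n ≃ Fin m × (Fin (g + 1) → K)) (F : Fin m → I → K)
    (hF : ∀ a b, a ≠ b → ∀ d : K, d ≠ 0 → ∃ i, F a i - F b i = d)
    (hq : (g + 1) * Nat.card K ^ g * Nat.card I + 1 ≤ q) :
    IsPartInt q (groupConstraint fun x => (e x).1) := by
  let col : Option ((Fin (g + 1) × (Fin g → K)) × I) → Fin n → (Fin (g + 1) → K) := fun ω x =>
    ω.elim (e x).2 fun w => (e x).2 + F (e x).1 w.2 • Fin.insertNth w.1.1 (1 : K) w.1.2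
  refine isPartInt_groupConstraint ?_ col ?_ ?_
  · refine le_trans (le_of_eq ?_) hq
    rw [Finite.card_option, Nat.card_prod, Nat.card_prod, Nat.card_fun]
    simp
  · intro ω x y hxy h
    refine e.injective (Prod.ext hxy ?_)
    cases ω with
    | none => exact h
    | some w => simpa [col, hxy] using h
  · intro x y hxy
    by_cases hs : (e x).2 = (e y).2
    · exact ⟨none, hs⟩
    · obtain ⟨j, hj⟩ : ∃ j, ((e y).2 - (e x).2) j ≠ 0 := by
        by_contra! hall
        exact hs (sub_eq_zero.1 (funext hall)).symm
      set δ := (e y).2 - (e x).2 with hδ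
      obtain ⟨i, hi⟩ := hF _ _ hxy (δ j) hj
      refine ⟨some ((j, fun k => δ (j.succAbove k) / δ j), i), ?_⟩
      have hw : δ j • Fin.insertNth (α := fun _ => K) j (1 : K)
          (fun k => δ (j.succAbove k) / δ j) = δ := by
        funext k
        rcases Fin.eq_self_or_eq_succAbove j k with rfl | ⟨k, rfl⟩
        · simp
        · simp [mul_div_cancel₀ _ hj]
      change (e x).2 + F (e x).1 i • Fin.insertNth (α := fun _ => K) j (1 : K) _ =
        (e y).2 + F (e y).1 i • Fin.insertNth (α := fun _ => K) j (1 : K) _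
      generalize Fin.insertNth (α := fun _ => K) j (1 : K)
        (fun k => δ (j.succAbove k) / δ j) = w at hw ⊢
      rw [← hi, sub_smul, hδ] at hw
      rw [add_comm (e x).2, sub_eq_sub_iff_add_eq_add.1 hw]

/-! ### The gambler -/

instance {n : ℕ} (D : Fin n → ProbabilityMeasure ℝ≥0) : IsProbabilityMeasure (valueLaw D) := by
  unfold valueLaw; infer_instance

/-- A product measure integrates the product of the `j`-th coordinate and the indicator of an event
that does not depend on it to the product of the integrals. -/
lemma setLIntegral_eval_of_update_mem_iff {n : ℕ} (D : Fin n → ProbabilityMeasure ℝ≥0) (j : Fin n)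
    {E : Set (Fin n → ℝ≥0)} (hE : MeasurableSet E)
    (hj : ∀ x v, Function.update x j v ∈ E ↔ x ∈ E) :
    ∫⁻ x in E, (x j : ℝ≥0∞) ∂valueLaw D =
      valueLaw D E * ∫⁻ v, (v : ℝ≥0∞) ∂(D j : Measure ℝ≥0) := by
  cases n with
  | zero => exact j.elim0
  | succ m =>
    have hmp := measurePreserving_piFinSuccAbove (fun i => (D i : Measure ℝ≥0)) j
    let E' : Set (Fin m → ℝ≥0) := {r | j.insertNth (α := fun _ => ℝ≥0) 0 r ∈ E}
    have hE' : MeasurableSet E' :=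
      hE.preimage ((MeasurableEquiv.piFinSuccAbove (fun _ => ℝ≥0) j).symm.measurable.comp
        measurable_prodMk_left)
    have hmem : ∀ x, x ∈ E ↔ (MeasurableEquiv.piFinSuccAbove (fun _ => ℝ≥0) j x).2 ∈ E' := by
      intro x
      rw [← hj x 0]
      change _ ↔ j.insertNth (α := fun _ => ℝ≥0) 0 (j.removeNth x) ∈ E
      rw [Fin.insertNth_removeNth]
    have key : ∀ f : ℝ≥0 → ℝ≥0∞, Measurable f → ∫⁻ x in E, f (x j) ∂valueLaw D =
        (∫⁻ v, f v ∂(D j : Measure ℝ≥0)) *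
          Measure.pi (fun i => (D (j.succAbove i) : Measure ℝ≥0)) E' := by
      intro f hf
      have hind : Measurable (E'.indicator (1 : (Fin m → ℝ≥0) → ℝ≥0∞)) :=
        measurable_one.indicator hE'
      rw [← lintegral_indicator hE, ← lintegral_indicator_one hE',
        ← lintegral_prod_mul hf.aemeasurable hind.aemeasurable, ← hmp.lintegral_comp
          (f := fun z => f z.1 * E'.indicator 1 z.2)
          ((hf.comp measurable_fst).mul (hind.comp measurable_snd))]
      refine lintegral_congr fun x => ?_
      by_cases hx : x ∈ E
      · rw [Set.indicator_of_mem hx, Set.indicator_of_mem ((hmem x).1 hx)]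
        simp
      · rw [Set.indicator_of_notMem hx, Set.indicator_of_notMem fun h => hx ((hmem x).2 h)]
        simp
    -- For `f = 1` this identifies the measure of `E'` with that of `E`.
    have h1 := key 1 measurable_one
    simp only [Pi.one_apply, lintegral_one, Measure.restrict_apply_univ, measure_univ,
      one_mul] at h1
    rw [key _ measurable_coe_nnreal_ennreal, h1, mul_comm]

/-- The event that `i` is the first element that is accepted. -/
def firstAccepted {n : ℕ} {I : Constraint n} (A : GamblerStrategy I) (i : Fin n) :
    Set (Fin n → ℝ≥0) :=
  {x | i ∈ A.accepted x ∧ ∀ j < i, j ∉ A.accepted x}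

lemma measurableSet_firstAccepted {n : ℕ} {I : Constraint n} (A : GamblerStrategy I) (i : Fin n) :
    MeasurableSet (firstAccepted A i) := by
  have : firstAccepted A i =
      {x | i ∈ A.accepted x} ∩ ⋂ j, ⋂ (_ : j < i), {x | j ∈ A.accepted x}ᶜ := by
    ext x; simp [firstAccepted]
  rw [this]
  exact (A.measurable i).inter (.iInter fun j => .iInter fun _ => (A.measurable j).compl)

/-- Whether `i` is the first accepted element does not depend on the values revealed later. -/
lemma update_mem_firstAccepted_iff {n : ℕ} {I : Constraint n} (A : GamblerStrategy I)
    {i j : Fin n} (hij : i < j) (x : Fin n → ℝ≥0) (v : ℝ≥0) :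
    Function.update x j v ∈ firstAccepted A i ↔ x ∈ firstAccepted A i := by
  have h : ∀ k ≤ i, (k ∈ A.accepted (Function.update x j v) ↔ k ∈ A.accepted x) := fun k hk =>
    A.online k _ _ fun l hl => Function.update_of_ne ((hl.trans hk).trans_lt hij).ne _ _
  refine and_congr (h i le_rfl) (forall₂_congr fun k hk => not_congr (h k hk.le))

lemma pairwise_disjoint_firstAccepted {n : ℕ} {I : Constraint n} (A : GamblerStrategy I) :
    Pairwise (Function.onFun Disjoint (firstAccepted A)) := by
  intro i j hij
  refine Set.disjoint_left.2 fun x hi hj => ?_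
  rcases lt_or_gt_of_ne hij with h | h
  · exact hj.2 i h hi.1
  · exact hi.2 j h hj.1

/-- The first accepted element is worth at most `1`, and all the others are among the later
elements of its group. -/
lemma sum_accepted_le {n : ℕ} {Γ : Type*} [DecidableEq Γ] {grp : Fin n → Γ}
    (A : GamblerStrategy (groupConstraint grp)) {x : Fin n → ℝ≥0} (hx : ∀ i, x i ≤ 1) :
    ∑ i ∈ A.accepted x, (x i : ℝ≥0∞) ≤ ∑ i, (firstAccepted A i).indicator
      (fun x => 1 + ∑ j with i < j ∧ grp j = grp i, (x j : ℝ≥0∞)) x := by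
  rcases (A.accepted x).eq_empty_or_nonempty with h0 | hne
  · simp [h0]
  obtain ⟨i, hi, hmin⟩ := Finset.exists_minimal hne
  have hfirst : x ∈ firstAccepted A i :=
    ⟨hi, fun j hj hjA => absurd (hmin hjA hj.le) (not_le.2 hj)⟩
  have hfeas : A.accepted x ∈ groupConstraint grp := by
    have := A.feasible x n
    rwa [Finset.filter_true_of_mem fun i _ => i.2] at this
  refine le_trans ?_ (Finset.single_le_sum (fun _ _ => zero_le) (Finset.mem_univ i))
  rw [Set.indicator_of_mem hfirst, ← Finset.add_sum_erase _ _ hi]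
  refine add_le_add (by exact_mod_cast hx i) (Finset.sum_le_sum_of_subset fun j hj => ?_)
  obtain ⟨hji, hjA⟩ := Finset.mem_erase.1 hj
  refine Finset.mem_filter.2 ⟨Finset.mem_univ j, lt_of_le_of_ne ?_ hji.symm, hfeas j hjA i hi⟩
  by_contra hlt
  exact hfirst.2 j (not_le.1 hlt) hjA

/-- When the values are at most `1` and groups have at most total mean `1`, the gambler gets at
most `1` from the first accepted element and, in expectation, at most `1` from the later ones. -/
lemma value_le_two {n s : ℕ} {Γ : Type*} [DecidableEq Γ] {grp : Fin n → Γ}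
    (hs : ∀ i, (Finset.univ.filter fun j => grp j = grp i).card ≤ s)
    {D : Fin n → ProbabilityMeasure ℝ≥0} {β : ℝ≥0∞}
    (hle : ∀ i, ∀ᵐ v ∂(D i : Measure ℝ≥0), v ≤ 1)
    (hβ : ∀ i, ∫⁻ v, (v : ℝ≥0∞) ∂(D i : Measure ℝ≥0) ≤ β) (hsβ : s * β ≤ 1)
    (A : GamblerStrategy (groupConstraint grp)) : A.value D ≤ 2 := by
  have hae : ∀ᵐ x ∂valueLaw D, ∀ i, x i ≤ 1 := ae_all_iff.2 fun i =>
    (measurePreserving_eval (fun i => (D i : Measure ℝ≥0)) i).quasiMeasurePreserving.ae (hle i)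
  have hmeas : ∀ i : Fin n, Measurable fun x : Fin n → ℝ≥0 => (x i : ℝ≥0∞) := fun i =>
    (measurable_pi_apply i).coe_nnreal_ennreal
  calc A.value D
      ≤ ∫⁻ x, ∑ i, (firstAccepted A i).indicator
          (fun x => 1 + ∑ j with i < j ∧ grp j = grp i, (x j : ℝ≥0∞)) x ∂valueLaw D :=
        lintegral_mono_ae (hae.mono fun x hx => sum_accepted_le A hx)
    _ = ∑ i, ∫⁻ x in firstAccepted A i,
          (1 + ∑ j with i < j ∧ grp j = grp i, (x j : ℝ≥0∞)) ∂valueLaw D := by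
        have hsum : ∀ i : Fin n, Measurable fun x : Fin n → ℝ≥0 =>
            1 + ∑ j with i < j ∧ grp j = grp i, (x j : ℝ≥0∞) := fun i =>
          measurable_const.add (Finset.measurable_sum _ fun j _ => hmeas j)
        rw [lintegral_finsetSum _ fun i _ =>
          (hsum i).indicator (measurableSet_firstAccepted A i)]
        simp_rw [lintegral_indicator (measurableSet_firstAccepted A _)]
    _ ≤ ∑ i, valueLaw D (firstAccepted A i) * 2 := by
        refine Finset.sum_le_sum fun i _ => ?_
        rw [lintegral_add_left measurable_const, lintegral_finsetSum _ fun j _ => hmeas j,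
          lintegral_one, Measure.restrict_apply_univ, mul_two]
        gcongr
        calc ∑ j with i < j ∧ grp j = grp i, ∫⁻ x in firstAccepted A i, (x j : ℝ≥0∞) ∂valueLaw D
            ≤ ∑ j with i < j ∧ grp j = grp i, valueLaw D (firstAccepted A i) * β := by
              refine Finset.sum_le_sum fun j hj => ?_
              rw [setLIntegral_eval_of_update_mem_iff D j (measurableSet_firstAccepted A i)
                (update_mem_firstAccepted_iff A (Finset.mem_filter.1 hj).2.1)]
              gcongr
              exact hβ j
          _ ≤ s * (valueLaw D (firstAccepted A i) * β) := by
              rw [Finset.sum_const, nsmul_eq_mul]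
              gcongr
              exact (Finset.card_le_card (Finset.monotone_filter_right _
                fun j _ h => h.2)).trans (hs i)
          _ ≤ valueLaw D (firstAccepted A i) := by
              rw [mul_left_comm]
              exact mul_le_of_le_one_right' hsβ
    _ ≤ 2 := by
        rw [← Finset.sum_mul]
        have := sum_measure_le_measure_univ (μ := valueLaw D) (s := Finset.univ)
          (fun i _ => (measurableSet_firstAccepted A i).nullMeasurableSet)
          fun i _ j _ hij => (pairwise_disjoint_firstAccepted A hij).aedisjoint
        rw [measure_univ] at this
        exact mul_le_of_le_one_left' this

/-! ### The prophet -/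

/-- For independent values with the same law `ν`, the probability that no group consists of ones
only. -/
lemma measure_forall_exists_ne_one {n : ℕ} {Γ S : Type*} [Fintype Γ] [Fintype S]
    (e : Fin n ≃ Γ × S) {D : Fin n → ProbabilityMeasure ℝ≥0} (ν : Measure ℝ≥0)
    [IsProbabilityMeasure ν] (hD : ∀ i, (D i : Measure ℝ≥0) = ν) :
    valueLaw D {x | ∀ γ, ∃ s, x (e.symm (γ, s)) ≠ 1} =
      (1 - ν {1} ^ Fintype.card S) ^ Fintype.card Γ := by
  have hmeas : MeasurableSet {z : S → ℝ≥0 | ∀ s, z s = 1} := by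
    simp only [Set.ofPred_forall]
    exact .iInter fun s => measurableSet_eq_fun (measurable_pi_apply s) measurable_const
  have hone : Measure.pi (fun _ : S => ν) {z | ∃ s, z s ≠ 1} = 1 - ν {1} ^ Fintype.card S := by
    have hc : {z : S → ℝ≥0 | ∃ s, z s ≠ 1} = {z | ∀ s, z s = 1}ᶜ := by ext z; simp
    have hp : {z : S → ℝ≥0 | ∀ s, z s = 1} = Set.univ.pi fun _ => {1} := by ext z; simp
    rw [hc, measure_compl hmeas (measure_ne_top _ _), measure_univ, hp, Measure.pi_pi,
      Finset.prod_const, Finset.card_univ]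
  have hcurry : Measurable fun (y : Γ → S → ℝ≥0) i => y (e i).1 (e i).2 :=
    measurable_pi_lambda _ fun i => (measurable_pi_apply _).comp (measurable_pi_apply _)
  have hlaw : valueLaw D = (Measure.pi fun _ : Γ => Measure.pi fun _ : S => ν).map
      (fun y i => y (e i).1 (e i).2) := by
    refine Measure.pi_eq fun t ht => ?_
    rw [Measure.map_apply hcurry (.univ_pi ht)]
    have hpre : (fun (y : Γ → S → ℝ≥0) i => y (e i).1 (e i).2) ⁻¹' Set.univ.pi t =
        Set.univ.pi fun γ => Set.univ.pi fun s => t (e.symm (γ, s)) := by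
      ext y
      simp only [Set.mem_preimage, Set.mem_univ_pi]
      refine ⟨fun h γ s => by simpa using h (e.symm (γ, s)), fun h i => ?_⟩
      simpa using h (e i).1 (e i).2
    rw [hpre, Measure.pi_pi]
    simp only [Measure.pi_pi, hD]
    rw [← Fintype.prod_prod_type' fun γ s => ν (t (e.symm (γ, s))),
      ← Equiv.prod_comp e]
    simp
  have hset : MeasurableSet {x : Fin n → ℝ≥0 | ∀ γ, ∃ s, x (e.symm (γ, s)) ≠ 1} := by
    simp only [Set.ofPred_forall, Set.ofPred_exists]
    exact .iInter fun γ => .iUnion fun s =>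
      (measurableSet_eq_fun (measurable_pi_apply _) measurable_const).compl
  rw [hlaw, Measure.map_apply hcurry hset]
  have hpre : (fun (y : Γ → S → ℝ≥0) i => y (e i).1 (e i).2) ⁻¹'
      {x | ∀ γ, ∃ s, x (e.symm (γ, s)) ≠ 1} = Set.univ.pi fun _ => {z | ∃ s, z s ≠ 1} := by
    ext y; simp
  rw [hpre, Measure.pi_pi, Finset.prod_const, hone, Finset.card_univ]

/-- If there are at least `1 / θ` independent events of probability `θ`, one of them happens with
probability at least `1 / 2`. -/
lemma one_sub_pow_le_half {θ : ℝ} (h0 : 0 ≤ θ) (h1 : θ ≤ 1) {m : ℕ} (hm : 1 ≤ m * θ) :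
    (1 - θ) ^ m ≤ 1 / 2 := by
  have hb : 1 + m * θ ≤ (1 + θ) ^ m := one_add_mul_le_pow (by linarith) m
  have hp : (1 - θ) ^ m * (1 + θ) ^ m ≤ 1 := by
    rw [← mul_pow]
    exact pow_le_one₀ (by nlinarith) (by nlinarith)
  have hn : 0 ≤ (1 - θ) ^ m := pow_nonneg (by linarith) m
  nlinarith

/-- With `m ≥ s ^ s` groups of `s` elements, each of value `1` with probability `1 / s`, some group
consists of ones only with probability at least `1 / 2`. -/
lemma half_le_prophetValue {n m s : ℕ} {S : Type*} [Fintype S] (hS : Fintype.card S = s)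
    (hs : 1 ≤ s) (hm : s ^ s ≤ m) (e : Fin n ≃ Fin m × S) {D : Fin n → ProbabilityMeasure ℝ≥0}
    (ν : Measure ℝ≥0) [IsProbabilityMeasure ν] (hD : ∀ i, (D i : Measure ℝ≥0) = ν)
    (hν : ν {1} = ENNReal.ofReal (1 / s)) :
    ENNReal.ofReal (s / 2) ≤ prophetValue (groupConstraint fun x => (e x).1) D := by
  classical
  have hs0 : (0 : ℝ) < s := by exact_mod_cast hs
  set E : Set (Fin n → ℝ≥0) := {x | ∀ γ, ∃ s, x (e.symm (γ, s)) ≠ 1} with hEdef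
  have hset : MeasurableSet E := by
    simp only [hEdef, Set.ofPred_forall, Set.ofPred_exists]
    exact .iInter fun γ => .iUnion fun s =>
      (measurableSet_eq_fun (measurable_pi_apply _) measurable_const).compl
  have hE : valueLaw D E ≤ ENNReal.ofReal (1 / 2) := by
    have hθ : (1 / s : ℝ) ^ s ≤ 1 := pow_le_one₀ (by positivity) (by
      rw [div_le_one hs0]; exact_mod_cast hs)
    rw [measure_forall_exists_ne_one e ν hD, hν, hS, Fintype.card_fin,
      ← ENNReal.ofReal_pow (by positivity), ← ENNReal.ofReal_one,
      ← ENNReal.ofReal_sub _ (by positivity), ← ENNReal.ofReal_pow (by linarith)]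
    refine ENNReal.ofReal_le_ofReal (one_sub_pow_le_half (by positivity) hθ ?_)
    rw [one_div, inv_pow, ← div_eq_mul_inv, one_le_div (by positivity)]
    exact_mod_cast hm
  have hEc : ENNReal.ofReal (1 / 2) ≤ valueLaw D Eᶜ := by
    rw [measure_compl hset (measure_ne_top _ _), measure_univ]
    refine le_trans ?_ (tsub_le_tsub_left hE 1)
    rw [← ENNReal.ofReal_one, ← ENNReal.ofReal_sub _ (by norm_num)]
    norm_num
  calc ENNReal.ofReal (s / 2) = s * ENNReal.ofReal (1 / 2) := by
        rw [← ENNReal.ofReal_natCast s, ← ENNReal.ofReal_mul (by positivity)]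
        ring_nf
    _ ≤ s * valueLaw D Eᶜ := by gcongr
    _ = ∫⁻ _ in Eᶜ, (s : ℝ≥0∞) ∂valueLaw D := by rw [setLIntegral_const]
    _ ≤ ∫⁻ x in Eᶜ, ⨆ T ∈ groupConstraint fun x => (e x).1, ∑ i ∈ T, (x i : ℝ≥0∞)
          ∂valueLaw D := by
        refine setLIntegral_mono' hset.compl fun x hx => ?_
        obtain ⟨γ, hγ⟩ : ∃ γ, ∀ s, x (e.symm (γ, s)) = 1 := by simpa [hEdef] using hx
        have hinj : Function.Injective fun s => e.symm (γ, s) := fun a b hab => by simpa using hab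
        let T : Finset (Fin n) := Finset.univ.map ⟨fun s => e.symm (γ, s), hinj⟩
        have hsum : ∑ i ∈ T, (x i : ℝ≥0∞) = s := by
          rw [Finset.sum_map]
          simp only [Function.Embedding.coeFn_mk, hγ]
          simp [hS]
        have hT : T ∈ groupConstraint fun x => (e x).1 := by
          simp only [groupConstraint, Set.mem_ofPred_eq, T, Finset.forall_mem_map,
            Function.Embedding.coeFn_mk, Equiv.apply_symm_apply, implies_true]
        exact hsum.ge.trans (le_iSup₂ (f := fun T _ => ∑ i ∈ T, (x i : ℝ≥0∞)) T hT)
    _ ≤ prophetValue _ D := setLIntegral_le_lintegral _ _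

/-! ### The ratio -/

/-- The union of `m ≥ s ^ s` cliques of size `s`, with values that are `1` with probability
`1 / s`: the prophet gets at least `s / 2` and the gambler at most `2`. -/
lemma exists_iidBernoulli_approximability {n m s : ℕ} {S : Type*} [Fintype S]
    (hS : Fintype.card S = s) (hs : 1 ≤ s) (hm : s ^ s ≤ m) (e : Fin n ≃ Fin m × S) :
    ∃ D ∈ iidBernoulli n,
      ENNReal.ofReal (s / 4) ≤ approximability (groupConstraint fun x => (e x).1) D := by
  have hs0 : (0 : ℝ) < s := by exact_mod_cast hs
  let b : unitInterval := ⟨1 / s, by positivity, by rw [div_le_one hs0]; exact_mod_cast hs⟩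
  have hb : (unitInterval.toNNReal b : ℝ≥0∞) = ENNReal.ofReal (1 / s) := by
    rw [← ENNReal.ofReal_coe_nnreal]; rfl
  let ν : Measure ℝ≥0 := ProbabilityTheory.bernoulliMeasure (1 : ℝ≥0) 0 b
  have hν : ν {1} = ENNReal.ofReal (1 / s) := by
    classical
    rw [← hb]
    simp [ν]
  have hle : ∀ᵐ v ∂ν, v ≤ 1 := by
    classical
    have hmeas : MeasurableSet {v : ℝ≥0 | ¬ v ≤ 1} :=
      (measurableSet_le measurable_id measurable_const).compl
    rw [ae_iff, ProbabilityTheory.bernoulliMeasure_apply b hmeas]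
    simp
  have hmean : ∫⁻ v, (v : ℝ≥0∞) ∂ν = ENNReal.ofReal (1 / s) := by
    rw [← hb]
    simp only [ν, ProbabilityTheory.bernoulliMeasure_def, lintegral_add_measure,
      lintegral_smul_measure, lintegral_dirac, ENNReal.smul_def]
    simp
  let D : Fin n → ProbabilityMeasure ℝ≥0 := fun _ => ⟨ν, inferInstance⟩
  refine ⟨D, ⟨b, fun _ => rfl⟩, ?_⟩
  have hgam : gamblerValue (groupConstraint fun x => (e x).1) D ≤ 2 := by
    refine iSup_le fun A => value_le_two (s := s) (D := D) (β := ENNReal.ofReal (1 / s)) ?_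
      (fun _ => hle) (fun _ => hmean.le) ?_ A
    · intro i
      rw [← hS, ← Finset.card_univ]
      refine Finset.card_le_card_of_injOn (fun j => (e j).2) (fun _ _ => Finset.mem_coe.2
        (Finset.mem_univ _)) fun j hj k hk hjk => e.injective (Prod.ext ?_ hjk)
      simp only [Finset.coe_filter, Finset.mem_univ, true_and] at hj hk
      exact hj.trans hk.symm
    · rw [← ENNReal.ofReal_natCast s, ← ENNReal.ofReal_mul hs0.le, mul_one_div_cancel hs0.ne',
        ENNReal.ofReal_one]
  calc ENNReal.ofReal (s / 4) = ENNReal.ofReal (s / 2) / 2 := by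
        rw [show (2 : ℝ≥0∞) = ENNReal.ofReal 2 by simp, ← ENNReal.ofReal_div_of_pos two_pos]
        ring_nf
    _ ≤ approximability _ D :=
        ENNReal.div_le_div (half_le_prophetValue hS hs hm e ν (fun _ => rfl) hν) hgam

/-! ### The parameters -/

/-- The instance with the field of `2 ^ u` elements and groups of size `2 ^ (u * (g + 1))`. -/
lemma exists_symPartInt_approximability {u g t q : ℕ} (hu : 1 ≤ u)
    (hcode : (u - 1) * (t + 1) ^ u + u * (g + 1) * 2 ^ (u * (g + 1)) ≤ u * t ^ u)
    (hq : (g + 1) * (2 ^ u) ^ g * t ^ u + 1 ≤ q) :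
    ∃ n : ℕ, ∃ I ∈ symPartInt q n, ∃ D ∈ iidBernoulli n,
      ENNReal.ofReal (2 ^ (u * (g + 1)) / 4) ≤ approximability I D := by
  have : Fact (Nat.Prime 2) := ⟨Nat.prime_two⟩
  let K := GaloisField 2 u
  have hK : Nat.card K = 2 ^ u := GaloisField.card 2 u (by omega)
  have : Finite K := Nat.finite_of_card_ne_zero (by rw [hK]; positivity)
  have : Fintype K := Fintype.ofFinite K
  set s := 2 ^ (u * (g + 1)) with hs
  have hS : Fintype.card (Fin (g + 1) → K) = s := by
    rw [Fintype.card_fun, Fintype.card_fin, ← Nat.card_eq_fintype_card, hK, ← pow_mul]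
  obtain ⟨F, hF⟩ := exists_code (V := K) (fun v => CharTwo.add_self_eq_zero v) hu hK t (s ^ s) (by
    nth_rewrite 1 [hs]
    rw [← pow_mul, ← pow_add]
    exact Nat.pow_le_pow_right two_pos hcode)
  let e : Fin (s ^ s * s) ≃ Fin (s ^ s) × (Fin (g + 1) → K) :=
    Fintype.equivOfCardEq (by rw [Fintype.card_prod, hS, Fintype.card_fin, Fintype.card_fin])
  obtain ⟨D, hD, hα⟩ := exists_iidBernoulli_approximability hS Nat.one_le_two_pow le_rfl e
  refine ⟨_, _, ⟨isFullySymmetric_groupConstraint e, isPartInt_of_code e F hF ?_⟩, D, hD, ?_⟩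
  · rw [hK, Nat.card_fun, Nat.card_fin, Nat.card_fin]
    exact hq
  · simpa [hs] using hα

/-- The exponents for `exists_code`: as `(t + 1) ^ u` exceeds `t ^ u` by a factor of about
`1 + u / t` only, some colour class has at least `2 ^ (t ^ u / 2)` words. -/
lemma sub_one_mul_succ_pow_add_le {u t N : ℕ} (hu : 1 ≤ u) (ht : 2 * u ^ 2 ≤ t)
    (hN : 2 * N ≤ t ^ u) : (u - 1) * (t + 1) ^ u + N ≤ u * t ^ u := by
  obtain ⟨v, rfl⟩ : ∃ v, u = v + 1 := ⟨u - 1, by omega⟩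
  set u := v + 1 with hu'
  have huR : (u : ℝ) = v + 1 := by simp [hu']
  have ht' : 2 * (u : ℝ) ^ 2 ≤ t := by exact_mod_cast ht
  have hv : (0 : ℝ) ≤ v := v.cast_nonneg
  have htpos : (0 : ℝ) < t + 1 := by positivity
  have hgap : (0 : ℝ) < t + 1 - u := by nlinarith
  have hbern : ((t : ℝ) + 1) ^ u * (t + 1 - u) ≤ t ^ u * (t + 1) := by
    have h := one_add_mul_le_pow (a := -(1 / ((t : ℝ) + 1))) (by
      have : 1 / ((t : ℝ) + 1) ≤ 1 := by rw [div_le_one htpos]; linarith [t.cast_nonneg (α := ℝ)]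
      linarith) u
    have h1 : 1 + (u : ℝ) * -(1 / ((t : ℝ) + 1)) = (t + 1 - u) / (t + 1) := by
      field_simp; ring
    have h2 : 1 + -(1 / ((t : ℝ) + 1)) = t / (t + 1) := by field_simp; ring
    rw [h1, h2, div_pow, div_le_div_iff₀ htpos (by positivity)] at h
    linarith
  have hkey : 2 * (v : ℝ) * (t + 1) ^ u ≤ (2 * u - 1) * t ^ u := by
    refine le_of_mul_le_mul_right ?_ hgap
    calc 2 * (v : ℝ) * (t + 1) ^ u * (t + 1 - u)
        = 2 * v * (((t : ℝ) + 1) ^ u * (t + 1 - u)) := by ring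
      _ ≤ 2 * v * (t ^ u * (t + 1)) := by gcongr
      _ = (2 * v * (t + 1)) * t ^ u := by ring
      _ ≤ ((2 * u - 1) * (t + 1 - u)) * t ^ u := by
          refine mul_le_mul_of_nonneg_right ?_ (by positivity)
          rw [huR] at ht' ⊢
          nlinarith
      _ = (2 * u - 1) * t ^ u * (t + 1 - u) := by ring
  have hNR : 2 * (N : ℝ) ≤ t ^ u := by exact_mod_cast hN
  have : (v : ℝ) * (t + 1) ^ u + N ≤ u * t ^ u := by linarith
  rw [hu', Nat.add_sub_cancel, ← hu']
  exact_mod_cast this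

/-- The number of colourings: with `t = 3 * 2 ^ g` it is about `(3 / 4) ^ u` times the square of
the group size `2 ^ (u * (g + 1))`, so that the group size may exceed `√q` by about
`2 ^ (u / 8)`. -/
lemma coloring_count_le {u g q l : ℕ} (hl : 2 ^ l ≤ q) (hul : 8 * (u * (g + 1)) ≤ 4 * l + u)
    (hu : 16 * ((g + 1 : ℕ) : ℝ) ^ 4 ≤ (3 / 2) ^ u) :
    (g + 1) * (2 ^ u) ^ g * (3 * 2 ^ g) ^ u + 1 ≤ q := by
  set Q := (g + 1) * (2 ^ u) ^ g * (3 * 2 ^ g) ^ u with hQ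
  have hQ1 : 1 ≤ Q := Nat.pos_of_ne_zero (by positivity)
  have hexp : Q * 4 ^ u = (g + 1) * 3 ^ u * 2 ^ (2 * (u * (g + 1))) := by
    rw [hQ, mul_pow, show (4 : ℕ) = 2 ^ 2 by norm_num, ← pow_mul, ← pow_mul, ← pow_mul]
    ring
  have hmain : ((2 * Q : ℕ) : ℝ) ^ 4 ≤ (q : ℝ) ^ 4 := by
    have hR : (Q : ℝ) * 4 ^ u = (g + 1 : ℕ) * 3 ^ u * 2 ^ (2 * (u * (g + 1))) := by
      exact_mod_cast hexp
    have h256 : (0 : ℝ) < 256 ^ u := by positivity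
    refine le_of_mul_le_mul_right ?_ h256
    calc ((2 * Q : ℕ) : ℝ) ^ 4 * 256 ^ u = 16 * ((Q : ℝ) * 4 ^ u) ^ 4 := by
          rw [show (256 : ℝ) = 4 ^ 4 by norm_num, ← pow_mul, mul_comm 4 u, pow_mul]
          push_cast; ring
      _ = 16 * ((g + 1 : ℕ) : ℝ) ^ 4 * 81 ^ u * 2 ^ (8 * (u * (g + 1))) := by
          rw [hR, show (81 : ℝ) = 3 ^ 4 by norm_num, ← pow_mul]
          ring
      _ ≤ (3 / 2) ^ u * 81 ^ u * 2 ^ (4 * l + u) := by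
          gcongr
          norm_num
      _ = ((3 / 2) * 81 * 2) ^ u * (2 ^ l) ^ 4 := by
          rw [mul_pow, mul_pow, pow_add, ← pow_mul, mul_comm 4 l]; ring
      _ ≤ 256 ^ u * (q : ℝ) ^ 4 := by
          gcongr
          · norm_num
          · exact_mod_cast hl
      _ = (q : ℝ) ^ 4 * 256 ^ u := by ring
  have h2Q : 2 * Q ≤ q := by
    exact_mod_cast le_of_pow_le_pow_left₀ (by norm_num) (by positivity) hmain
  omega

/-- The exponents `1 / 2` and `c / log log q` are compared in terms of `log₂ q` and
`log₂ log₂ q`. -/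
lemma bound_le_of_exponent_le {q l k e : ℕ} (hk : 5 ≤ k) (hkl : 2 ^ k ≤ l) (hl : 2 ^ l ≤ q)
    (hq : q < 2 ^ (l + 1))
    (he : ((l : ℝ) + 1) * (1 / 2 + 1 / 512 / (k - 1)) ≤ e - 2) :
    bound (1 / 1024) q ≤ ENNReal.ofReal (2 ^ e / 4) := by
  have hk' : (5 : ℝ) ≤ k := by exact_mod_cast hk
  have hlogtwo : (1 / 2 : ℝ) ≤ Real.log 2 := by linarith [Real.log_two_gt_d9]
  have hq0 : (0 : ℝ) < q := by exact_mod_cast (Nat.two_pow_pos l).trans_le hl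
  have hlog : (l : ℝ) / 2 ≤ Real.log q := by
    have := Real.log_le_log (by positivity) (show (2 : ℝ) ^ l ≤ q by exact_mod_cast hl)
    rw [Real.log_pow] at this
    nlinarith [l.cast_nonneg (α := ℝ)]
  have hloglog : ((k : ℝ) - 1) / 2 ≤ Real.log (Real.log q) := by
    have h2 : (2 : ℝ) ^ (k - 1) ≤ Real.log q := by
      refine le_trans ?_ hlog
      rw [le_div_iff₀ two_pos, ← pow_succ, Nat.sub_add_cancel (by omega)]
      exact_mod_cast hkl
    have := Real.log_le_log (by positivity) h2
    rw [Real.log_pow, Nat.cast_sub (by omega), Nat.cast_one] at this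
    nlinarith
  have hexp : (1 / 2 + 1 / 1024 / Real.log (Real.log q) : ℝ) ≤ 1 / 2 + 1 / 512 / (k - 1) := by
    have : (1 / 1024 / Real.log (Real.log q) : ℝ) ≤ 1 / 1024 / (((k : ℝ) - 1) / 2) :=
      div_le_div_of_nonneg_left (by norm_num) (by linarith) hloglog
    rw [show (1 / 512 / ((k : ℝ) - 1)) = 1 / 1024 / (((k : ℝ) - 1) / 2) by
      field_simp; norm_num]
    linarith
  have hexp0 : (0 : ℝ) ≤ 1 / 2 + 1 / 512 / (k - 1) := by
    have : (0 : ℝ) ≤ 1 / 512 / (k - 1) := div_nonneg (by norm_num) (by linarith)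
    linarith
  refine ENNReal.ofReal_le_ofReal ?_
  calc (q : ℝ) ^ (1 / 2 + 1 / 1024 / Real.log (Real.log q) : ℝ)
      ≤ (q : ℝ) ^ (1 / 2 + 1 / 512 / ((k : ℝ) - 1) : ℝ) :=
        Real.rpow_le_rpow_of_exponent_le (by exact_mod_cast (show 1 ≤ q by exact_mod_cast hq0)) hexp
    _ ≤ ((2 : ℝ) ^ ((l : ℝ) + 1)) ^ (1 / 2 + 1 / 512 / ((k : ℝ) - 1) : ℝ) := by
        refine Real.rpow_le_rpow hq0.le ?_ hexp0
        have : (q : ℝ) ≤ 2 ^ (l + 1) := by exact_mod_cast hq.le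
        rw [← Real.rpow_natCast] at this
        simpa using this
    _ = (2 : ℝ) ^ (((l : ℝ) + 1) * (1 / 2 + 1 / 512 / ((k : ℝ) - 1))) :=
        (Real.rpow_mul (by norm_num) _ _).symm
    _ ≤ (2 : ℝ) ^ ((e : ℝ) - 2) := Real.rpow_le_rpow_of_exponent_le (by norm_num) he
    _ = 2 ^ e / 4 := by
        rw [Real.rpow_sub two_pos, Real.rpow_natCast]
        norm_num

lemma eventually_pow_four_le : ∃ u₁ : ℕ, ∀ u ≥ u₁, (u : ℝ) ^ 4 ≤ (3 / 2) ^ u := by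
  have h := (tendsto_pow_const_div_const_pow_of_one_lt 4 (r := (3 / 2 : ℝ))
    (by norm_num)).eventually_le_const one_pos
  obtain ⟨u₁, hu₁⟩ := Filter.eventually_atTop.1 h
  exact ⟨u₁, fun u hu => by simpa using (div_le_one (by positivity)).1 (hu₁ u hu)⟩

lemma eventually_mul_le_two_pow (u₁ : ℕ) :
    ∃ k₁ : ℕ, ∀ k ≥ k₁, (4 * k + 8) * (32 * k + 129 + u₁) ≤ 2 ^ k := by
  have h := ((tendsto_pow_const_div_const_pow_of_one_lt 2 (r := (2 : ℝ))
    (by norm_num)).eventually_le_const (u := (1 / (12 * (161 + u₁)) : ℝ))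
      (by positivity))
  obtain ⟨k₁, hk₁⟩ := Filter.eventually_atTop.1 h
  refine ⟨max k₁ 1, fun k hk => ?_⟩
  have h1 := hk₁ k (le_trans (le_max_left _ _) hk)
  have hk1 : 1 ≤ k := le_trans (le_max_right _ _) hk
  rw [div_le_div_iff₀ (by positivity) (by positivity), one_mul] at h1
  have h2 : k ^ 2 * (12 * (161 + u₁)) ≤ 2 ^ k := by exact_mod_cast h1
  refine le_trans ?_ h2
  calc (4 * k + 8) * (32 * k + 129 + u₁) ≤ (12 * k) * ((161 + u₁) * k) :=
        Nat.mul_le_mul (by omega) (by nlinarith)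
    _ = k ^ 2 * (12 * (161 + u₁)) := by ring

/-- For large `q`, with `l = log₂ q` and `k = log₂ l`, the parameters `g + 1 = 2 k + 4` and
`u ≈ l / (2 (g + 1))` give an instance whose group size exceeds `√q` by a factor exponential in
`u`. -/
lemma exists_bound_le : ∃ q₀ : ℕ, ∀ q ≥ q₀,
    ∃ n : ℕ, ∃ I ∈ symPartInt q n, ∃ D ∈ iidBernoulli n,
      bound (1 / 1024) q ≤ approximability I D := by
  obtain ⟨u₁, hu₁⟩ := eventually_pow_four_le
  obtain ⟨k₁, hk₁⟩ := eventually_mul_le_two_pow u₁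
  refine ⟨2 ^ 2 ^ max k₁ 5, fun q hq => ?_⟩
  have hq0 : q ≠ 0 := ((Nat.two_pow_pos _).trans_le hq).ne'
  set l := Nat.log 2 q with hl
  have hlq : 2 ^ l ≤ q := Nat.pow_log_le_self 2 hq0
  have hql : q < 2 ^ (l + 1) := Nat.lt_pow_succ_log_self one_lt_two q
  have hl0 : 2 ^ max k₁ 5 ≤ l := Nat.le_log_of_pow_le one_lt_two hq
  have hlne : l ≠ 0 := ((Nat.two_pow_pos _).trans_le hl0).ne'
  set k := Nat.log 2 l with hk
  have hkl : 2 ^ k ≤ l := Nat.pow_log_le_self 2 hlne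
  have hlk : l < 2 ^ (k + 1) := Nat.lt_pow_succ_log_self one_lt_two l
  have hk0 : max k₁ 5 ≤ k := Nat.le_log_of_pow_le one_lt_two hl0
  have hk5 : 5 ≤ k := le_trans (le_max_right _ _) hk0
  have hkk := hk₁ k (le_trans (le_max_left _ _) hk0)
  -- With this `g`, the bound `2 * u ^ 2 ≤ 3 * 2 ^ g` follows from `u < 2 ^ (k + 1)`. The number `u`
  -- is the largest one with `2 * u * (g + 1) - u / 4 ≤ l`; the term `u / 4` uses up a part of the
  -- factor `(3 / 4) ^ u` that is saved in the number of colourings.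
  set g := 2 * k + 3 with hg
  set u := 4 * l / (8 * g + 7) with hu
  have hul : u * (8 * g + 7) ≤ 4 * l := Nat.div_mul_le_self _ _
  have hlu : 4 * l < (u + 1) * (8 * g + 7) := by
    rw [add_mul, one_mul]
    exact Nat.lt_div_mul_add (by omega)
  have hularge : 32 * k + 128 + u₁ ≤ u := by
    by_contra! hlt
    have h1 : (4 * k + 8) * (u + 1) ≤ l :=
      (Nat.mul_le_mul_left _ (by omega)).trans (hkk.trans hkl)
    nlinarith
  have hpow : (u : ℝ) ^ 4 ≤ (3 / 2) ^ u := hu₁ u (by omega)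
  have hgu : 16 * (g + 1) ≤ u := by omega
  have hule : u ≤ l := by nlinarith
  have ht : 2 * u ^ 2 ≤ 3 * 2 ^ g := by
    have h1 : u ^ 2 ≤ (2 ^ (k + 1)) ^ 2 := Nat.pow_le_pow_left (by omega) 2
    have h2 : 2 ^ g = 2 * (2 ^ (k + 1)) ^ 2 := by rw [hg]; ring
    omega
  have hN : 2 * (u * (g + 1) * 2 ^ (u * (g + 1))) ≤ (3 * 2 ^ g) ^ u := by
    have h1 : (2 * (u * (g + 1)) : ℝ) * 2 ^ u ≤ 3 ^ u := by
      have hu16 : (16 * (g + 1) : ℝ) ≤ u := by exact_mod_cast hgu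
      have hu1 : (1 : ℝ) ≤ u := by nlinarith [g.cast_nonneg (α := ℝ)]
      have h2 : (2 * (u * (g + 1)) : ℝ) ≤ (3 / 2) ^ u := by
        refine le_trans ?_ hpow
        calc (2 * (u * (g + 1)) : ℝ) ≤ u * u := by nlinarith
          _ = (u : ℝ) ^ 2 := by ring
          _ ≤ (u : ℝ) ^ 4 := pow_le_pow_right₀ hu1 (by norm_num)
      calc (2 * (u * (g + 1)) : ℝ) * 2 ^ u ≤ (3 / 2) ^ u * 2 ^ u := by gcongr
        _ = 3 ^ u := by rw [← mul_pow]; norm_num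
    have h1' : 2 * (u * (g + 1)) * 2 ^ u ≤ 3 ^ u := by exact_mod_cast h1
    calc 2 * (u * (g + 1) * 2 ^ (u * (g + 1)))
        = (2 * (u * (g + 1)) * 2 ^ u) * (2 ^ g) ^ u := by
          rw [show 2 ^ (u * (g + 1)) = 2 ^ u * (2 ^ g) ^ u by
            rw [← pow_mul, ← pow_add, mul_add, mul_one, mul_comm g, add_comm]]
          simp only [mul_assoc]
      _ ≤ 3 ^ u * (2 ^ g) ^ u := by gcongr
      _ = (3 * 2 ^ g) ^ u := (mul_pow _ _ _).symm
  have hcount := coloring_count_le (u := u) (g := g) hlq (by nlinarith) (by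
    refine le_trans ?_ hpow
    have hu16 : (16 * ((g + 1 : ℕ) : ℝ)) ≤ u := by exact_mod_cast hgu
    calc 16 * ((g + 1 : ℕ) : ℝ) ^ 4 ≤ (16 * ((g + 1 : ℕ) : ℝ)) ^ 4 := by
          rw [mul_pow]; gcongr; norm_num
      _ ≤ (u : ℝ) ^ 4 := by gcongr)
  obtain ⟨n, I, hI, D, hD, hα⟩ := exists_symPartInt_approximability (t := 3 * 2 ^ g) (by omega)
    (sub_one_mul_succ_pow_add_le (by omega) ht hN) hcount
  refine ⟨n, I, hI, D, hD, le_trans (bound_le_of_exponent_le hk5 hkl hlq hql ?_) hα⟩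
  have hk5R : (5 : ℝ) ≤ k := by exact_mod_cast hk5
  have hgR : (g : ℝ) = 2 * k + 3 := by rw [hg]; push_cast; ring
  have hluR : 4 * (l : ℝ) ≤ (u + 1) * (8 * g + 7) := by exact_mod_cast hlu.le
  have hularR : 32 * (k : ℝ) + 128 ≤ u := by exact_mod_cast (by omega : 32 * k + 128 ≤ u)
  have hlR : (1 : ℝ) ≤ l := by exact_mod_cast Nat.one_le_iff_ne_zero.2 hlne
  have hfrac : ((l : ℝ) + 1) * (1 / 512 / (k - 1)) ≤ (u + 1) / 32 := by
    rw [div_div, mul_one_div, div_le_div_iff₀ (by linarith) (by norm_num)]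
    rw [hgR] at hluR
    nlinarith
  push_cast
  rw [hgR] at hluR ⊢
  nlinarith

end Prophet

theorem theorem1 :
    ∃ c : ℝ, 0 < c ∧ ∃ q₀ : ℕ, ∀ q : ℕ, q₀ ≤ q →
      Prophet.bound c q ≤ Prophet.alpha (Prophet.partInt q) ∧
      Prophet.bound c q ≤ Prophet.alphaWith (Prophet.symPartInt q) Prophet.iidBernoulli ∧
      ∃ n : ℕ, ∃ I ∈ Prophet.symPartInt q n, ∃ D ∈ Prophet.iidBernoulli n,
        Prophet.bound c q ≤ Prophet.approximability I D := by
  obtain ⟨q₀, hq₀⟩ := Prophet.exists_bound_le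
  refine ⟨1 / 1024, by norm_num, q₀, fun q hq => ?_⟩
  obtain ⟨n, I, hI, D, hD, h⟩ := hq₀ q hq
  refine ⟨?_, ?_, n, I, hI, D, hD, h⟩
  · exact h.trans (le_iSup_of_le n (le_iSup₂_of_le I hI.2
      (le_iSup₂_of_le D (Set.mem_univ D) le_rfl)))
  · exact h.trans (le_iSup_of_le n (le_iSup₂_of_le I hI (le_iSup₂_of_le D hD le_rfl)))
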